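/- Let $\mathbb N=\{0,1,2,\dots\}$, let $\mathbf A:\mathbb N\times\mathbb N\to\{0,1\}$ be a transition matrix, and let $\Sigma_{\mathbf A}(\mathbb N)=\{x\in\mathbb N^{\mathbb N}:\mathbf A(x_i,x_{i+1})=1\ \forall i\ge 0\}$, with the topology induced by the product of the discrete topologies, the Borel $\sigma$-algebra, and the shift $(\sigma x)_i=x_{i+1}$. For $\mathcal A\subset\mathbb N$ put $\Sigma_{\mathbf A}(\mathcal A)=\{x\in\Sigma_{\mathbf A}(\mathbb N): x_i\in\mathcal A\ \forall i\ge 0\}$, and let $\mathcal M_\sigma(\cdot)$ denote the set of shift-invariant Borel probability measures. A $0$-$1$ matrix is called irreducible if for any two symbols $i,j$ of its index set there is a finite (possibly empty) word $w$ of symbols such that all consecutive transitions in $iwj$ are allowed. Assume that $\mathbf A$ is irreducible and that $f:\Sigma_{\mathbf A}(\mathbb N)\to\mathbb R$ satisfies (a) $f$ has bounded (summable) variation: $\sum_{j\ge1}V_j(f)<\infty$, where $V_j(f)=\sup\{f(x)-f(y): x_i=y_i \text{ for } 0\le i<j\}$; (b) $f$ is coercive: $\lim_{i\to\infty}\sup\{f(x):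 x\in\Sigma_{\mathbf A}(\mathbb N),\ x_0=i\}=-\infty$. Let $\beta=\sup_{\mu\in\mathcal M_\sigma(\Sigma_{\mathbf A}(\mathbb N))}\int f\,d\mu$ (the integrals take values in $[-\infty,\infty)$, since $f$ is bounded above), and call $\nu\in\mathcal M_\sigma(\Sigma_{\mathbf A}(\mathbb N))$ maximizing if $\int f\,d\nu=\beta$. Then $\beta$ is a real number, and there is a finite set $\mathcal A\subset\mathbb N$ such that the restriction $\mathbf A|_{\mathcal A\times\mathcal A}$ is irreducible, $\Sigma_{\mathbf A}(\mathcal A)$ is compact, and \[ \beta=\sup_{\mu\in\mathcal M_\sigma(\Sigma_{\mathbf A}(\mathcal A))}\int f\,d\mu . \] Moreover, there is a maximizing measure whose support is contained in $\Sigma_{\mathbf A}(\mathcal A)$, and every maximizing measure $\nu$ satisfies $\operatorname{supp}\nu\subset\Sigma_{\mathbf A}(\mathcal A)$. -/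

import Mathlib

open Filter Topology MeasureTheory

/-- The set of allowable sequences of the `0`-`1` transition matrix `A`, with the topology induced
by the product of the discrete topologies (this is the topology of each of the metrics
`d x y = lam ^ k`, `0 < lam < 1`, where `k` is the first coordinate with `x k ≠ y k`) and with the
induced product σ-algebra, which is the Borel σ-algebra. -/
abbrev MarkovShift (A : Matrix ℕ ℕ (Fin 2)) : Type :=
  {x : ℕ → ℕ // ∀ i, A (x i) (x (i + 1)) = 1}

/-- Any two symbols `i`, `j` are connected by a word `w` such that `i w j` is allowable. -/
def IrreducibleTransition {α : Type*} (A : Matrix α α (Fin 2)) : Prop :=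
  ∀ i j : α, ∃ w : List α, List.IsChain (fun a b => A a b = 1) (i :: (w ++ [j]))

namespace MarkovShift

variable {A : Matrix ℕ ℕ (Fin 2)}

/-- The shift map. -/
def shift (x : MarkovShift A) : MarkovShift A :=
  ⟨fun i => x.1 (i + 1), fun i => x.2 (i + 1)⟩

/-- The cylinder of the sequences that begin with the symbol `i`. -/
def cylinder (A : Matrix ℕ ℕ (Fin 2)) (i : ℕ) : Set (MarkovShift A) :=
  {x | x.1 0 = i}

/-- The `j`-th variation of `f`, as an extended nonnegative number. (The pairs `x = y` are
allowed, so cutting the negative differences off at `0` does not change the supremum.) -/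
noncomputable def variation (f : MarkovShift A → ℝ) (j : ℕ) : ENNReal :=
  ⨆ (x : MarkovShift A) (y : MarkovShift A) (_ : ∀ i < j, x.1 i = y.1 i), ENNReal.ofReal (f x - f y)

/-- The variations of order `j ≥ 1` have a finite sum. -/
def BoundedVariation (f : MarkovShift A → ℝ) : Prop :=
  ∑' j : ℕ, variation f (j + 1) < ⊤

/-- The supremum of `f` over the cylinder of `i` tends to `-∞` as `i → ∞`. -/
def Coercive (f : MarkovShift A → ℝ) : Prop :=
  Tendsto (fun i : ℕ => ⨆ x ∈ cylinder A i, (f x : EReal)) atTop (𝓝 ⊥)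

/-- The allowable sequences all of whose symbols belong to `S`. -/
def subshift (A : Matrix ℕ ℕ (Fin 2)) (S : Set ℕ) : Set (MarkovShift A) :=
  {x | ∀ i, x.1 i ∈ S}

/-- The shift map of the subshift with symbols in `S`. -/
def subshiftMap (A : Matrix ℕ ℕ (Fin 2)) (S : Set ℕ) (x : subshift A S) : subshift A S :=
  ⟨shift x.1, fun i => x.2 (i + 1)⟩

end MarkovShift

/-- The integral of `f` as an extended real number, `∫ f⁺ - ∫ f⁻`. It is meaningful as soon as `f`
is measurable and one of the two parts has a finite integral, for example if `f` is bounded above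
and the measure is finite; its value may then be `-∞`. -/
noncomputable def extIntegral {X : Type*} [MeasurableSpace X] (f : X → ℝ) (μ : Measure X) : EReal :=
  ((∫⁻ x, ENNReal.ofReal (f x) ∂μ : ENNReal) : EReal)
    - ((∫⁻ x, ENNReal.ofReal (-f x) ∂μ : ENNReal) : EReal)

/-- The `T`-invariant probability measures. -/
def invariantProb {X : Type*} [MeasurableSpace X] (T : X → X) : Set (Measure X) :=
  {μ | IsProbabilityMeasure μ ∧ MeasurePreserving T μ μ}

/-- The supremum of the integrals of `f` over the `T`-invariant probability measures. -/
noncomputable def maxErgodicValue {X : Type*} [MeasurableSpace X] (T : X → X) (f : X → ℝ) : EReal :=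
  ⨆ μ ∈ invariantProb T, extIntegral f μ

/-- `ν` is a maximizing measure for `f`: an invariant probability measure that attains the
supremum. -/
def IsMaximizing {X : Type*} [MeasurableSpace X] (T : X → X) (f : X → ℝ) (ν : Measure X) : Prop :=
  ν ∈ invariantProb T ∧ extIntegral f ν = maxErgodicValue T f

/-! Write `b` for the maximal integral. The core is a bounded function `v`, with `0 ≤ v ≤ C`, such
that `f - b ≤ v - v ∘ shift` (`exists_subaction`). For a maximizing measure both sides have integral
zero, so equality holds almost everywhere, and by invariance along almost every whole orbit. Hence
`f ≥ b - C` along these orbits, and coercivity leaves only finitely many symbols. Irreducibility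
enlarges this set to a finite irreducible one.

The function `v` is the supremum of the Birkhoff sums of `f - b`, so these need a uniform upper
bound (`exists_birkhoffSum_le`). A word whose end symbols lie in the finite set where `f` can reach
`b` is closed up to a periodic orbit by one of finitely many paths. The orbit average is at most
`b`, bounded variation controls the change of the sum on the word, and the path costs a bounded
amount.

A maximizing measure exists because coercivity makes near-maximizing invariant measures tight; a
weak limit is maximizing since the integral of `M - f ≥ 0` is lower semicontinuous. -/

/-! ### Irreducible matrices and finite sets of symbols -/

theorem Relation.transGen_iff_exists_isChain {α : Type*} {r : α → α → Prop} {a b : α} :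
    Relation.TransGen r a b ↔ ∃ w : List α, List.IsChain r (a :: (w ++ [b])) := by
  constructor
  · intro h
    induction h using Relation.TransGen.head_induction_on with
    | single h => exact ⟨[], by simpa using h⟩
    | head h _ ih =>
      obtain ⟨w, hw⟩ := ih
      exact ⟨_ :: w, by simpa using ⟨h, hw⟩⟩
  · rintro ⟨w, hw⟩
    induction w generalizing a with
    | nil => exact .single (by simpa using hw)
    | cons c w ih =>
      rw [List.cons_append, List.isChain_cons_cons] at hw
      exact .head hw.1 (ih hw.2)

theorem irreducibleTransition_iff_transGen {α : Type*} {A : Matrix α α (Fin 2)} :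
    IrreducibleTransition A ↔ ∀ i j, Relation.TransGen (fun a b => A a b = 1) i j := by
  simp only [IrreducibleTransition, Relation.transGen_iff_exists_isChain]

theorem Relation.TransGen.exists_path {α : Type*} {r : α → α → Prop} {a b : α}
    (h : Relation.TransGen r a b) :
    ∃ n, 0 < n ∧ ∃ c : ℕ → α, c 0 = a ∧ c n = b ∧ ∀ k < n, r (c k) (c (k + 1)) := by
  induction h using Relation.TransGen.head_induction_on with
  | @single a h =>
    refine ⟨1, one_pos, fun k => if k = 0 then a else b, by simp, by simp, ?_⟩
    intro k hk
    obtain rfl : k = 0 := by omega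
    simpa using h
  | @head a d h _ ih =>
    obtain ⟨n, hn, c, h0, h1, hc⟩ := ih
    refine ⟨n + 1, by omega, fun k => Nat.casesOn k a c, rfl, h1, ?_⟩
    rintro (_ | k) hk
    · simpa [h0] using h
    · exact hc k (by omega)

/-- Every finite set of symbols of an irreducible matrix lies in a finite set of symbols on which
the matrix is irreducible. -/
theorem IrreducibleTransition.exists_finset {α : Type*} [DecidableEq α] {A : Matrix α α (Fin 2)}
    (hA : IrreducibleTransition A) (F : Finset α) :
    ∃ S : Finset α, F ⊆ S ∧
      IrreducibleTransition (A.submatrix ((↑) : S → α) ((↑) : S → α)) := by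
  rw [irreducibleTransition_iff_transGen] at hA
  choose n hn c hc0 hcn hc using fun i j => (hA i j).exists_path
  let S : Finset α := (F ×ˢ F).biUnion fun p => (Finset.range (n p.1 p.2 + 1)).image (c p.1 p.2)
  have hmem : ∀ i ∈ F, ∀ j ∈ F, ∀ k ≤ n i j, c i j k ∈ S := by
    intro i hi j hj k hk
    simp only [S, Finset.mem_biUnion, Finset.mem_image, Finset.mem_range, Prod.exists,
      Finset.mem_product]
    exact ⟨i, j, ⟨hi, hj⟩, k, by omega, rfl⟩
  have hS : ∀ s ∈ S, ∃ i ∈ F, ∃ j ∈ F, ∃ k ≤ n i j, c i j k = s := by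
    intro s hs
    simp only [S, Finset.mem_biUnion, Finset.mem_image, Finset.mem_range, Prod.exists,
      Finset.mem_product] at hs
    obtain ⟨i, j, ⟨hi, hj⟩, k, hk, rfl⟩ := hs
    exact ⟨i, hi, j, hj, k, by omega, rfl⟩
  refine ⟨S, fun i hi => by simpa [hc0] using hmem i hi i hi 0 (Nat.zero_le _), ?_⟩
  rw [irreducibleTransition_iff_transGen]
  set r : S → S → Prop := fun a b => A.submatrix ((↑) : S → α) ((↑) : S → α) a b = 1 with hr
  have seg : ∀ i (hi : i ∈ F) j (hj : j ∈ F) a b (hab : a ≤ b) (hb : b ≤ n i j),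
      Relation.ReflTransGen r ⟨c i j a, hmem i hi j hj a (hab.trans hb)⟩
        ⟨c i j b, hmem i hi j hj b hb⟩ := by
    intro i hi j hj a b hab hb
    induction b, hab using Nat.le_induction with
    | base => exact .refl
    | succ b hab ih => exact (ih (by omega)).tail (hc i j b (by omega))
  rintro ⟨s, hs⟩ ⟨t, ht⟩
  obtain ⟨i, hi, j, hj, k, hk, rfl⟩ := hS s hs
  obtain ⟨i', hi', j', hj', k', hk', rfl⟩ := hS t ht
  have h1 := seg i hi j hj k _ hk le_rfl
  have h3 := seg i' hi' j' hj' 0 k' (Nat.zero_le _) hk'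
  -- The first edge of the path from `j` to `i'` is kept apart, as `h2'`: it ensures that the
  -- composite path has at least one edge even if the other segments are trivial.
  have h2 := seg j hj i' hi' 1 _ (hn j i') le_rfl
  simp only [hcn, hc0] at h1 h2 h3
  have h2' : r ⟨j, hcn i j ▸ hmem i hi j hj _ le_rfl⟩
      ⟨c j i' 1, hmem j hj i' hi' 1 (hn j i')⟩ := by
    have := hc j i' 0 (hn j i')
    rw [hc0] at this
    exact this
  exact (Relation.TransGen.head' h2' h2).trans_right h1 |>.trans_left h3

/-! ### Topology of the shift, variation and coercivity -/

namespace MarkovShift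

variable {A : Matrix ℕ ℕ (Fin 2)} {f : MarkovShift A → ℝ}

theorem iterate_shift_apply (x : MarkovShift A) (k i : ℕ) : (shift^[k] x).1 i = x.1 (i + k) := by
  induction k generalizing i with
  | zero => rfl
  | succ k ih =>
    rw [Function.iterate_succ_apply', shift]
    simp only [ih]
    rw [add_assoc, add_comm 1 k]

theorem continuous_shift : Continuous (shift (A := A)) :=
  (continuous_pi fun i => (continuous_apply (i + 1)).comp continuous_subtype_val :
    Continuous fun (x : MarkovShift A) i => x.1 (i + 1)).subtype_mk _

theorem measurable_shift : Measurable (shift (A := A)) :=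
  continuous_shift.measurable

theorem isClosed_subshift (S : Set ℕ) : IsClosed (subshift A S) := by
  have : subshift A S = ⋂ i, (fun x : MarkovShift A => x.1 i) ⁻¹' S := by
    ext x; simp [subshift]
  rw [this]
  exact isClosed_iInter fun i => (isClosed_discrete S).preimage
    ((continuous_apply i).comp continuous_subtype_val)

/-- The sequences with prescribed finite sets of symbols at each position form a compact set. -/
theorem isCompact_setOf_forall_mem (S : ℕ → Set ℕ) (hS : ∀ i, (S i).Finite) :
    IsCompact {x : MarkovShift A | ∀ i, x.1 i ∈ S i} := by
  have hcl : IsClosed {x : ℕ → ℕ | ∀ i, A (x i) (x (i + 1)) = 1} := by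
    simp only [Set.ofPred_forall]
    refine isClosed_iInter fun i => ?_
    have h : Continuous fun x : ℕ → ℕ => (x i, x (i + 1)) := by fun_prop
    exact (isClosed_discrete {p : ℕ × ℕ | A p.1 p.2 = 1}).preimage h
  have hc : IsCompact (Set.univ.pi S) := isCompact_univ_pi fun i => (hS i).isCompact
  have h : {x : MarkovShift A | ∀ i, x.1 i ∈ S i} = Subtype.val ⁻¹' Set.univ.pi S := by
    ext x
    simp
  rw [h]
  exact hcl.isClosedEmbedding_subtypeVal.isCompact_preimage hc

theorem BoundedVariation.summable (hf : BoundedVariation f) :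
    Summable fun j => (variation f (j + 1)).toReal :=
  ENNReal.summable_toReal (ne_of_lt hf)

theorem BoundedVariation.sub_le (hf : BoundedVariation f) {x y : MarkovShift A} {j : ℕ}
    (h : ∀ i < j + 1, x.1 i = y.1 i) : f x - f y ≤ (variation f (j + 1)).toReal := by
  have hfin : variation f (j + 1) ≠ ⊤ := ENNReal.ne_top_of_tsum_ne_top (ne_of_lt hf) j
  rw [← ENNReal.ofReal_le_iff_le_toReal hfin]
  exact le_iSup_of_le x (le_iSup_of_le y (le_iSup_of_le h le_rfl))

theorem BoundedVariation.continuous (hf : BoundedVariation f) : Continuous f := by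
  rw [continuous_iff_continuousAt]
  intro x
  rw [ContinuousAt, Metric.tendsto_nhds]
  intro ε hε
  obtain ⟨j, hj⟩ := (hf.summable.tendsto_atTop_zero.eventually (gt_mem_nhds hε)).exists
  have hev : ∀ᶠ y : MarkovShift A in 𝓝 x, ∀ i ∈ Finset.range (j + 1), y.1 i = x.1 i := by
    rw [Filter.eventually_all_finset]
    intro i _
    have : Continuous fun y : MarkovShift A => y.1 i :=
      (continuous_apply i).comp continuous_subtype_val
    exact this.continuousAt.eventually (by simp : ∀ᶠ z in 𝓝 (x.1 i), z = x.1 i)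
  filter_upwards [hev] with y hy
  rw [Real.dist_eq, abs_sub_lt_iff]
  have h : ∀ i < j + 1, y.1 i = x.1 i := fun i hi => hy i (Finset.mem_range.2 hi)
  exact ⟨(hf.sub_le h).trans_lt hj, (hf.sub_le fun i hi => (h i hi).symm).trans_lt hj⟩

/-- After `k` shifts the two sequences still agree on `n - k` symbols, so the differences are
bounded by distinct terms of the variation series. The bound does not depend on `n`. -/
theorem BoundedVariation.birkhoffSum_sub_le (hf : BoundedVariation f) {x y : MarkovShift A}
    {n : ℕ} (h : ∀ i < n, x.1 i = y.1 i) :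
    birkhoffSum shift f n x - birkhoffSum shift f n y ≤
      ∑' j, (variation f (j + 1)).toReal := by
  calc birkhoffSum shift f n x - birkhoffSum shift f n y
      = ∑ k ∈ Finset.range n, (f (shift^[k] x) - f (shift^[k] y)) := by
        simp [birkhoffSum]
    _ ≤ ∑ k ∈ Finset.range n, (variation f (n - 1 - k + 1)).toReal := by
        refine Finset.sum_le_sum fun k hk => hf.sub_le fun i hi => ?_
        rw [Finset.mem_range] at hk
        simp only [iterate_shift_apply]
        exact h _ (by omega)
    _ = ∑ k ∈ Finset.range n, (variation f (k + 1)).toReal :=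
        Finset.sum_range_reflect (fun k => (variation f (k + 1)).toReal) n
    _ ≤ _ := hf.summable.sum_le_tsum _ fun _ _ => ENNReal.toReal_nonneg

/-- The first variation is finite, so `f` oscillates boundedly on each cylinder. The lower bounds,
which coercivity cannot give, control the cost of joining paths. -/
theorem BoundedVariation.exists_bounds_on_cylinders (hf : BoundedVariation f) :
    ∃ l u : ℕ → ℝ, ∀ x, l (x.1 0) ≤ f x ∧ f x ≤ u (x.1 0) := by
  have key : ∀ s : ℕ, ∃ l u : ℝ, ∀ x : MarkovShift A, x.1 0 = s → l ≤ f x ∧ f x ≤ u := by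
    intro s
    by_cases hs : ∃ y : MarkovShift A, y.1 0 = s
    · obtain ⟨y, rfl⟩ := hs
      refine ⟨f y - (variation f (0 + 1)).toReal, f y + (variation f (0 + 1)).toReal,
        fun x hx => ?_⟩
      have h : ∀ i < 0 + 1, x.1 i = y.1 i := by
        intro i hi
        obtain rfl : i = 0 := by omega
        exact hx
      have h1 := hf.sub_le h
      have h2 := hf.sub_le fun i hi => (h i hi).symm
      constructor <;> linarith
    · exact ⟨0, 0, fun x hx => absurd ⟨x, hx⟩ hs⟩
  choose l u h using key
  exact ⟨l, u, fun x => h _ x rfl⟩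

theorem Coercive.finite_symbols (hf : Coercive f) (t : ℝ) :
    {s : ℕ | ∃ x : MarkovShift A, x.1 0 = s ∧ t ≤ f x}.Finite := by
  obtain ⟨N, hN⟩ := eventually_atTop.1
    (hf.eventually (gt_mem_nhds (EReal.bot_lt_coe t)))
  refine (Set.finite_lt_nat N).subset ?_
  rintro s ⟨x, hx, ht⟩
  by_contra hs
  have h1 : ((f x : ℝ) : EReal) < t :=
    lt_of_le_of_lt (le_iSup₂ (f := fun (x : MarkovShift A) (_ : x ∈ cylinder A s) =>
      ((f x : ℝ) : EReal)) x hx) (hN s (not_lt.1 hs))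
  exact absurd ht (not_le.2 (EReal.coe_lt_coe_iff.1 h1))

theorem Coercive.exists_le (hf : Coercive f) (hv : BoundedVariation f) : ∃ M, ∀ x, f x ≤ M := by
  obtain ⟨_, u, hu⟩ := hv.exists_bounds_on_cylinders
  obtain ⟨M, hM⟩ := ((hf.finite_symbols 0).image u).bddAbove
  refine ⟨max M 0, fun x => ?_⟩
  by_cases hx : 0 ≤ f x
  · exact (hu x).2.trans ((hM ⟨_, ⟨x, rfl, hx⟩, rfl⟩).trans (le_max_left _ _))
  · exact (not_le.1 hx).le.trans (le_max_right _ _)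

end MarkovShift

/-! ### Extended integrals, coboundaries and periodic orbit measures -/

section Integral

variable {X : Type*} [MeasurableSpace X] {μ : Measure X} {f : X → ℝ}

theorem extIntegral_eq_integral (hf : Integrable f μ) :
    extIntegral f μ = ((∫ x, f x ∂μ : ℝ) : EReal) := by
  have h1 : ∫⁻ x, ENNReal.ofReal (f x) ∂μ ≠ ⊤ := hf.lintegral_lt_top.ne
  have h2 : ∫⁻ x, ENNReal.ofReal (-f x) ∂μ ≠ ⊤ := hf.neg.lintegral_lt_top.ne
  rw [extIntegral, integral_eq_lintegral_pos_part_sub_lintegral_neg_part hf, EReal.coe_sub,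
    EReal.coe_ennreal_toReal h1, EReal.coe_ennreal_toReal h2]

/-- The positive part is bounded and the measure finite, so only the negative part can fail to be
integrable. -/
theorem extIntegral_eq_bot [IsFiniteMeasure μ] (hm : Measurable f) {M : ℝ} (hM : ∀ x, f x ≤ M)
    (hf : ¬ Integrable f μ) : extIntegral f μ = ⊥ := by
  have h2 : ∫⁻ x, ENNReal.ofReal (-f x) ∂μ = ⊤ := by
    by_contra h
    refine hf ?_
    have hg : Integrable (fun x => M - f x) μ := by
      refine ⟨by fun_prop, ?_⟩
      rw [hasFiniteIntegral_iff_ofReal (.of_forall fun x => sub_nonneg.2 (hM x))]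
      calc ∫⁻ x, ENNReal.ofReal (M - f x) ∂μ
          ≤ ∫⁻ x, (ENNReal.ofReal M + ENNReal.ofReal (-f x)) ∂μ :=
            lintegral_mono fun x => by
              rw [sub_eq_add_neg]
              exact ENNReal.ofReal_add_le
        _ = ENNReal.ofReal M * μ Set.univ + ∫⁻ x, ENNReal.ofReal (-f x) ∂μ := by
            rw [lintegral_add_left measurable_const, lintegral_const]
        _ < ⊤ := ENNReal.add_lt_top.2
            ⟨ENNReal.mul_lt_top ENNReal.ofReal_lt_top (measure_lt_top μ _), Ne.lt_top h⟩
    simpa [Pi.sub_def] using (integrable_const M).sub hg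
  rw [extIntegral, h2]
  simp

theorem coe_le_extIntegral_iff [IsFiniteMeasure μ] (hm : Measurable f) {M : ℝ}
    (hM : ∀ x, f x ≤ M) {b : ℝ} :
    (b : EReal) ≤ extIntegral f μ ↔ Integrable f μ ∧ b ≤ ∫ x, f x ∂μ := by
  by_cases hf : Integrable f μ
  · simp [extIntegral_eq_integral hf, hf]
  · simp [extIntegral_eq_bot hm hM hf, hf]

/-- This is the form suited to Markov's inequality and lower semicontinuity; `b ≤ M` keeps
`ENNReal.ofReal` from truncating. -/
theorem coe_le_extIntegral_iff_lintegral_le [IsProbabilityMeasure μ] (hm : Measurable f) {M : ℝ}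
    (hM : ∀ x, f x ≤ M) {b : ℝ} (hb : b ≤ M) :
    (b : EReal) ≤ extIntegral f μ ↔
      ∫⁻ x, ENNReal.ofReal (M - f x) ∂μ ≤ ENNReal.ofReal (M - b) := by
  rw [coe_le_extIntegral_iff hm hM]
  have hnn : 0 ≤ᵐ[μ] fun x => M - f x := .of_forall fun x => sub_nonneg.2 (hM x)
  constructor
  · rintro ⟨hf, h⟩
    have hg : Integrable (fun x => M - f x) μ := (integrable_const M).sub hf
    rw [← ofReal_integral_eq_lintegral_ofReal hg hnn]
    refine ENNReal.ofReal_le_ofReal ?_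
    rw [integral_sub (integrable_const M) hf]
    simp only [integral_const, probReal_univ, one_smul]
    linarith
  · intro h
    have hg : Integrable (fun x => M - f x) μ := by
      refine ⟨by fun_prop, ?_⟩
      rw [hasFiniteIntegral_iff_ofReal hnn]
      exact h.trans_lt ENNReal.ofReal_lt_top
    have hf : Integrable f μ := by simpa [Pi.sub_def] using (integrable_const M).sub hg
    refine ⟨hf, ?_⟩
    rw [← ofReal_integral_eq_lintegral_ofReal hg hnn,
      ENNReal.ofReal_le_ofReal_iff (sub_nonneg.2 hb), integral_sub (integrable_const M) hf] at h
    simp only [integral_const, probReal_univ, one_smul] at h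
    linarith

theorem extIntegral_le [IsProbabilityMeasure μ] (hm : Measurable f) {M : ℝ}
    (hM : ∀ x, f x ≤ M) : extIntegral f μ ≤ M := by
  by_cases hf : Integrable f μ
  · rw [extIntegral_eq_integral hf, EReal.coe_le_coe_iff]
    simpa using integral_mono hf (integrable_const M) hM
  · simp [extIntegral_eq_bot hm hM hf]

theorem extIntegral_map {Y : Type*} [MeasurableSpace Y] {φ : X → Y} (hφ : Measurable φ)
    {g : Y → ℝ} (hg : Measurable g) : extIntegral g (μ.map φ) = extIntegral (g ∘ φ) μ := by
  rw [extIntegral, extIntegral, lintegral_map (by fun_prop) hφ, lintegral_map (by fun_prop) hφ]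
  rfl

/-- If `f - b` is bounded by a bounded coboundary, then it agrees almost everywhere with the
coboundary for each invariant measure with integral `b`. -/
theorem ae_eq_of_le_coboundary [IsProbabilityMeasure μ] {T : X → X} (hT : MeasurePreserving T μ μ)
    (hf : Integrable f μ) {b : ℝ} (hb : ∫ x, f x ∂μ = b) {v : X → ℝ} (hv : Integrable v μ)
    (h : ∀ x, f x - b ≤ v x - v (T x)) : ∀ᵐ x ∂μ, f x - b = v x - v (T x) := by
  have hvT : Integrable (fun x => v (T x)) μ := hT.integrable_comp_of_integrable hv
  have hvi : ∫ x, v (T x) ∂μ = ∫ x, v x ∂μ := by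
    conv_rhs => rw [← hT.map_eq]
    rw [integral_map hT.measurable.aemeasurable]
    rw [hT.map_eq]
    exact hv.1
  have hfb : Integrable (fun x => f x - b) μ := hf.sub (integrable_const b)
  refine (integral_eq_iff_of_ae_le hfb (hv.sub hvT) (.of_forall h)).1 ?_
  simp only [Pi.sub_apply]
  rw [integral_sub hf (integrable_const b), integral_sub hv hvT, hvi, hb]
  simp

/-- The equidistributed measure on a periodic orbit is invariant, so that the average of `f` over
the orbit is at most the maximal integral. -/
theorem birkhoffSum_le_of_isPeriodicPt {T : X → X} (hT : Measurable T) (hf : Measurable f)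
    {x : X} {p : ℕ} (hp : 0 < p) (hx : T^[p] x = x) :
    ((birkhoffSum T f p x / p : ℝ) : EReal) ≤ maxErgodicValue T f := by
  set S : Measure X := ∑ k ∈ Finset.range p, Measure.dirac (T^[k] x) with hS
  set μ : Measure X := (p : ENNReal)⁻¹ • S with hμ
  have hp0 : (p : ENNReal) ≠ 0 := by exact_mod_cast hp.ne'
  have hprob : IsProbabilityMeasure μ := by
    constructor
    simp [hμ, hS, ENNReal.inv_mul_cancel hp0 (ENNReal.natCast_ne_top p)]
  have hmap : S.map T = S := by
    ext s hs
    rw [Measure.map_apply hT hs]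
    simp only [hS, Measure.coe_finsetSum, Finset.sum_apply, Measure.dirac_apply' _ hs,
      Measure.dirac_apply' _ (hT hs)]
    have h1 : ∀ k, (T ⁻¹' s).indicator (1 : X → ENNReal) (T^[k] x) =
        s.indicator 1 (T^[k + 1] x) := fun k => by
      rw [Function.iterate_succ_apply']
      rfl
    simp only [h1]
    -- Split the sum over `0, …, p` at its last and at its first term; these agree by periodicity
    -- and, being finite, cancel.
    have h2 := Finset.sum_range_succ (fun k => s.indicator (1 : X → ENNReal) (T^[k] x)) p
    rw [Finset.sum_range_succ', hx] at h2
    simpa using (ENNReal.add_left_inj (by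
      by_cases h : x ∈ s <;> simp [h])).1 h2
  have hinv : MeasurePreserving T μ μ := ⟨hT, by rw [hμ, Measure.map_smul, hmap]⟩
  have hint : ∀ k ∈ Finset.range p, Integrable f (Measure.dirac (T^[k] x)) := fun k _ =>
    ⟨hf.aestronglyMeasurable, by
      rw [HasFiniteIntegral, lintegral_dirac' _ (by fun_prop)]
      exact enorm_lt_top⟩
  have hintS : Integrable f S := integrable_finsetSum_measure.2 hint
  have hintμ : Integrable f μ := hintS.smul_measure (ENNReal.inv_ne_top.2 hp0)
  have hval : ∫ y, f y ∂μ = birkhoffSum T f p x / p := by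
    rw [hμ, integral_smul_measure, hS, integral_finsetSum_measure hint]
    simp only [integral_dirac' f _ hf.stronglyMeasurable]
    simp [birkhoffSum, div_eq_inv_mul]
  rw [← hval, ← extIntegral_eq_integral hintμ]
  exact le_iSup₂ (f := fun (ν : Measure X) (_ : ν ∈ invariantProb T) => extIntegral f ν) μ
    ⟨hprob, hinv⟩

end Integral

/-! ### Closing of words and the sub-action -/

namespace MarkovShift

variable {A : Matrix ℕ ℕ (Fin 2)} {f : MarkovShift A → ℝ}

/-- A word of an allowable sequence can be closed up to a periodic sequence with a path that joins
its last symbol to its first one. -/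
theorem exists_periodic (y : MarkovShift A) (m : ℕ) {n : ℕ} (hn : 0 < n) {c : ℕ → ℕ}
    (hc0 : c 0 = y.1 m) (hcn : c n = y.1 0) (hc : ∀ k < n, A (c k) (c (k + 1)) = 1) :
    ∃ z : MarkovShift A, shift^[m + n] z = z ∧ (∀ i < m + 1, z.1 i = y.1 i) ∧
      ∀ k < n, z.1 (m + k) = c k := by
  let w : ℕ → ℕ := fun r => if r ≤ m then y.1 r else c (r - m)
  have hw : ∀ k ≤ n, w (m + k) = c k := by
    intro k _
    rcases Nat.eq_zero_or_pos k with rfl | hk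
    · simp [w, hc0]
    · have h : ¬ m + k ≤ m := by omega
      simp [w, h]
  have hA : ∀ r < m + n, A (w r) (w (r + 1)) = 1 := by
    intro r hr
    rcases Nat.lt_or_ge r m with h | h
    · have h1 : r ≤ m := h.le
      have h2 : r + 1 ≤ m := h
      simp only [w, h1, h2, if_true]
      exact y.2 r
    · obtain ⟨k, rfl⟩ := Nat.exists_eq_add_of_le h
      rw [hw k (by omega), add_assoc, hw (k + 1) (by omega)]
      exact hc k (by omega)
  have hper : w (m + n) = w 0 := by
    rw [hw n le_rfl, hcn]
    simp [w]
  refine ⟨⟨fun k => w (k % (m + n)), fun k => ?_⟩, ?_, ?_, ?_⟩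
  · beta_reduce
    have hlt := Nat.mod_lt k (show 0 < m + n by omega)
    have h := hA _ hlt
    rcases Nat.lt_or_ge (k % (m + n) + 1) (m + n) with h1 | h1
    · have : (k + 1) % (m + n) = k % (m + n) + 1 := by
        rw [Nat.add_mod, Nat.mod_eq_of_lt (a := 1) (by omega), Nat.mod_eq_of_lt h1]
      rwa [this]
    · have h2 : k % (m + n) + 1 = m + n := by omega
      have : (k + 1) % (m + n) = 0 := by
        rw [← Nat.mod_add_mod, h2, Nat.mod_self]
      rw [this, ← hper]
      rwa [h2] at h
  · ext i
    rw [iterate_shift_apply]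
    simp
  · intro i hi
    simp only
    rw [Nat.mod_eq_of_lt (by omega)]
    simp [w, Nat.lt_succ_iff.1 hi]
  · intro k hk
    simp only
    rw [Nat.mod_eq_of_lt (by omega), hw k hk.le]

/-- The Birkhoff sums of `f - b` are bounded above when the sums over the periodic orbits are
nonpositive. -/
theorem exists_birkhoffSum_le (hA : IrreducibleTransition A) (hvar : BoundedVariation f)
    (hcoer : Coercive f) {b : ℝ}
    (hb : ∀ (p : ℕ) (x : MarkovShift A), 0 < p → shift^[p] x = x →
      birkhoffSum shift f p x ≤ p * b) :
    ∃ C, 0 ≤ C ∧ ∀ n x, birkhoffSum shift f n x ≤ n * b + C := by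
  rw [irreducibleTransition_iff_transGen] at hA
  choose n hn c hc0 hcn hc using fun i j => (hA i j).exists_path
  obtain ⟨l, u, hl⟩ := hvar.exists_bounds_on_cylinders
  set B := ∑' j, (variation f (j + 1)).toReal with hB
  have hB0 : 0 ≤ B := tsum_nonneg fun _ => ENNReal.toReal_nonneg
  let F := (hcoer.finite_symbols b).toFinset
  -- An upper bound for the loss along the interior of the joining path. Its end symbols are left
  -- out: they already belong to the word being closed.
  let D : ℕ → ℕ → ℝ := fun i j => ∑ k ∈ Finset.range (n i j - 1), (b - l (c i j (k + 1)))
  obtain ⟨E, hE⟩ := ((F ×ˢ F).image fun p => D p.1 p.2).bddAbove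
  refine ⟨B + max E 0, by positivity, fun N => ?_⟩
  have hmaxE : 0 ≤ max E 0 := le_max_right _ _
  induction N with
  | zero =>
    intro x
    simp only [birkhoffSum_zero, Nat.cast_zero, zero_mul, zero_add]
    positivity
  | succ m ih =>
    intro y
    -- A first or last term below `b` can be dropped and the induction hypothesis applied. Otherwise
    -- both end symbols lie in `F`, and the word is closed up.
    by_cases h0 : b ≤ f y
    swap
    · rw [birkhoffSum_succ']
      have := ih (shift y)
      push_cast
      linarith
    by_cases h1 : b ≤ f (shift^[m] y)
    swap
    · rw [birkhoffSum_succ]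
      have := ih y
      push_cast
      linarith
    have hi : y.1 0 ∈ F := by
      have : ∃ x : MarkovShift A, x.1 0 = y.1 0 ∧ b ≤ f x := ⟨y, rfl, h0⟩
      exact (Set.Finite.mem_toFinset _).2 this
    have hj : y.1 m ∈ F := by
      have : ∃ x : MarkovShift A, x.1 0 = y.1 m ∧ b ≤ f x :=
        ⟨shift^[m] y, by simp [iterate_shift_apply], h1⟩
      exact (Set.Finite.mem_toFinset _).2 this
    have hD : D (y.1 m) (y.1 0) ≤ E :=
      hE (Finset.mem_coe.2 (Finset.mem_image.2
        ⟨(y.1 m, y.1 0), Finset.mem_product.2 ⟨hj, hi⟩, rfl⟩))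
    obtain ⟨z, hz, hzy, hzc⟩ := exists_periodic y m (hn (y.1 m) (y.1 0)) (hc0 _ _) (hcn _ _)
      (hc _ _)
    obtain ⟨q, hq⟩ : ∃ q, n (y.1 m) (y.1 0) = q + 1 :=
      Nat.exists_eq_succ_of_ne_zero (hn (y.1 m) (y.1 0)).ne'
    have hp := hb _ z (by have := hn (y.1 m) (y.1 0); omega) hz
    rw [hq, show m + (q + 1) = (m + 1) + q by ring, birkhoffSum_add] at hp
    have hdist := hvar.birkhoffSum_sub_le (x := y) (y := z) (n := m + 1)
      fun i hi => (hzy i hi).symm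
    have hlow : q * b - birkhoffSum shift f q (shift^[m + 1] z) ≤ D (y.1 m) (y.1 0) := by
      simp only [D, birkhoffSum, hq, Nat.add_sub_cancel, Finset.sum_sub_distrib,
        Finset.sum_const, Finset.card_range, nsmul_eq_mul]
      refine sub_le_sub_left (Finset.sum_le_sum fun k hk => ?_) _
      rw [Finset.mem_range] at hk
      rw [← Function.iterate_add_apply, ← hzc (k + 1) (by omega)]
      have := (hl (shift^[k + (m + 1)] z)).1
      rwa [iterate_shift_apply, show 0 + (k + (m + 1)) = m + (k + 1) by ring] at this
    push_cast at hp ⊢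
    have := le_max_left E 0
    linarith

/-- A bounded sub-action. -/
theorem exists_subaction (hm : Measurable f) {b C : ℝ}
    (hC : ∀ n x, birkhoffSum shift f n x ≤ n * b + C) :
    ∃ v : MarkovShift A → ℝ, Measurable v ∧ (∀ x, 0 ≤ v x ∧ v x ≤ C) ∧
      ∀ x, f x - b ≤ v x - v (shift x) := by
  let g : ℕ → MarkovShift A → ℝ := fun n x => birkhoffSum shift f n x - n * b
  have hbdd : ∀ x, BddAbove (Set.range fun n => g n x) := by
    intro x
    refine ⟨C, ?_⟩
    rintro _ ⟨n, rfl⟩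
    have := hC n x
    simp only [g]
    linarith
  have hg : ∀ n, Measurable (g n) := by
    intro n
    refine Measurable.sub_const ?_ _
    unfold birkhoffSum
    exact Finset.measurable_fun_sum _ fun k _ => hm.comp (measurable_shift.iterate k)
  refine ⟨fun x => ⨆ n, g n x, Measurable.iSup hg, fun x => ⟨?_, ?_⟩, fun x => ?_⟩
  · exact le_ciSup_of_le (hbdd x) 0 (by simp [g])
  · refine ciSup_le fun n => ?_
    have := hC n x
    simp only [g]
    linarith
  · have : ⨆ n, g n (shift x) ≤ (⨆ n, g n x) - (f x - b) := by
      refine ciSup_le fun n => ?_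
      have h := le_ciSup (hbdd x) (n + 1)
      simp only [g, birkhoffSum_succ'] at h ⊢
      push_cast at h
      linarith
    linarith

end MarkovShift

/-! ### Existence and support of maximizing measures -/

namespace MarkovShift

variable {A : Matrix ℕ ℕ (Fin 2)} {f : MarkovShift A → ℝ}

/-- The invariant probability measures with a given upper bound for the integral of `M - f` are
tight. -/
theorem Coercive.isTightMeasureSet (hcoer : Coercive f) (hm : Measurable f) (M : ℝ)
    {K : ENNReal} (hK : K ≠ ⊤) :
    IsTightMeasureSet {μ : Measure (MarkovShift A) | μ ∈ invariantProb shift ∧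
      ∫⁻ x, ENNReal.ofReal (M - f x) ∂μ ≤ K} := by
  rw [isTightMeasureSet_iff_exists_isCompact_measure_compl_le]
  intro ε hε
  obtain ⟨δ, hδ, hsum⟩ := ENNReal.exists_pos_sum_of_countable' hε.ne' ℕ
  -- With `K < t i * δ i`, Markov's inequality gives mass at most `δ i` to the event `M - f ≥ t i`,
  -- at every time by invariance.
  choose t ht0 ht using fun i => ENNReal.exists_nat_pos_mul_gt (hδ i).ne' hK
  let S : ℕ → Set ℕ := fun i => {s | ∃ x : MarkovShift A, x.1 0 = s ∧ M - t i ≤ f x}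
  refine ⟨{x | ∀ i, x.1 i ∈ S i}, isCompact_setOf_forall_mem S fun i =>
    hcoer.finite_symbols _, ?_⟩
  rintro μ ⟨⟨_, hinv⟩, hμ⟩
  have hsub : {x : MarkovShift A | ∀ i, x.1 i ∈ S i}ᶜ ⊆
      ⋃ i, shift^[i] ⁻¹' {x : MarkovShift A | (t i : ENNReal) ≤ ENNReal.ofReal (M - f x)} := by
    intro x hx
    simp only [Set.mem_compl_iff, Set.mem_ofPred_eq, not_forall] at hx
    obtain ⟨i, hi⟩ := hx
    refine Set.mem_iUnion.2 ⟨i, ?_⟩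
    have h : f (shift^[i] x) < M - t i := by
      by_contra h
      exact hi ⟨shift^[i] x, by simp [iterate_shift_apply], not_lt.1 h⟩
    change (t i : ENNReal) ≤ ENNReal.ofReal (M - f (shift^[i] x))
    rw [← ENNReal.ofReal_natCast]
    exact ENNReal.ofReal_le_ofReal (by linarith)
  have hmeas : Measurable fun x => ENNReal.ofReal (M - f x) := by fun_prop
  calc μ {x : MarkovShift A | ∀ i, x.1 i ∈ S i}ᶜ
      ≤ ∑' i, μ (shift^[i] ⁻¹' {x | (t i : ENNReal) ≤ ENNReal.ofReal (M - f x)}) :=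
        (measure_mono hsub).trans (measure_iUnion_le _)
    _ ≤ ∑' i, δ i := by
        refine ENNReal.tsum_le_tsum fun i => ?_
        rw [(hinv.iterate i).measure_preimage
          (measurableSet_le measurable_const hmeas).nullMeasurableSet]
        refine (meas_ge_le_lintegral_div hmeas.aemeasurable
          (by exact_mod_cast (ht0 i).ne') (ENNReal.natCast_ne_top _)).trans ?_
        refine ENNReal.div_le_of_le_mul ?_
        rw [mul_comm]
        exact hμ.trans (ht i).le
    _ ≤ ε := hsum.le

instance : TopologicalSpace.MetrizableSpace (MarkovShift A) :=
  Topology.IsEmbedding.subtypeVal.metrizableSpace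

theorem exists_isMaximizing (hvar : BoundedVariation f) (hcoer : Coercive f) {b : ℝ}
    (hb : maxErgodicValue (shift (A := A)) f = b) :
    ∃ ν : Measure (MarkovShift A), IsMaximizing shift f ν := by
  have hm : Measurable f := hvar.continuous.measurable
  obtain ⟨M, hM⟩ := hcoer.exists_le hvar
  have key : ∀ b', b' < b → b' ≤ M ∧ ∃ μ : Measure (MarkovShift A), μ ∈ invariantProb shift ∧
      ∫⁻ x, ENNReal.ofReal (M - f x) ∂μ ≤ ENNReal.ofReal (M - b') := by
    intro b' hb'
    have h : (b' : EReal) < maxErgodicValue (shift (A := A)) f := by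
      rw [hb]
      exact EReal.coe_lt_coe_iff.2 hb'
    rw [maxErgodicValue] at h
    obtain ⟨μ, hμ⟩ := lt_iSup_iff.1 h
    obtain ⟨hinv, hμ⟩ := lt_iSup_iff.1 hμ
    have := hinv.1
    have hle : b' ≤ M := EReal.coe_le_coe_iff.1 (hμ.le.trans (extIntegral_le hm hM))
    exact ⟨hle, μ, hinv, (coe_le_extIntegral_iff_lintegral_le hm hM hle).1 hμ.le⟩
  have hbM : b ≤ M := le_of_forall_lt fun c hc => by
    obtain ⟨d, h1, h2⟩ := exists_between hc
    exact h1.trans_le (key d h2).1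
  choose μ hinv hμ using fun k : ℕ =>
    (key (b - 1 / ((k : ℝ) + 1)) (sub_lt_self b Nat.one_div_pos_of_nat)).2
  let P : ℕ → ProbabilityMeasure (MarkovShift A) := fun k => ⟨μ k, (hinv k).1⟩
  have htight : IsTightMeasureSet
      {((μ : ProbabilityMeasure (MarkovShift A)) : Measure (MarkovShift A)) |
        μ ∈ Set.range P} := by
    refine (hcoer.isTightMeasureSet hm M (K := ENNReal.ofReal (M - (b - 1)))
      ENNReal.ofReal_ne_top).subset ?_
    rintro _ ⟨_, ⟨k, rfl⟩, rfl⟩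
    refine ⟨hinv k, (hμ k).trans (ENNReal.ofReal_le_ofReal ?_)⟩
    have : 1 / ((k : ℝ) + 1) ≤ 1 := by
      rw [div_le_one (by positivity)]
      linarith [(Nat.cast_nonneg k : (0 : ℝ) ≤ k)]
    linarith
  obtain ⟨ν, -, φ, hφ, hν⟩ := (isCompact_closure_of_isTightMeasureSet htight).isSeqCompact
    (fun k => subset_closure (Set.mem_range_self k))
  have hνinv : (ν : Measure (MarkovShift A)).map shift = ν := by
    have h1 := ProbabilityMeasure.tendsto_map_of_tendsto_of_continuous _ _ hν continuous_shift
    have h2 : (fun k => ((P ∘ φ) k).map (continuous_shift (A := A)).measurable.aemeasurable) =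
        P ∘ φ := by
      funext k
      exact Subtype.ext (hinv (φ k)).2.map_eq
    rw [h2] at h1
    exact congrArg ProbabilityMeasure.toMeasure (tendsto_nhds_unique h1 hν)
  have hmem : (ν : Measure (MarkovShift A)) ∈ invariantProb shift :=
    ⟨inferInstance, measurable_shift, hνinv⟩
  refine ⟨ν, hmem, le_antisymm ?_ ?_⟩
  · exact le_iSup₂ (f := fun (ν : Measure (MarkovShift A)) (_ : ν ∈ invariantProb shift) =>
      extIntegral f ν) _ hmem
  · rw [hb, coe_le_extIntegral_iff_lintegral_le hm hM hbM]
    have hlim : Tendsto (fun k : ℕ => ENNReal.ofReal (M - (b - 1 / ((φ k : ℝ) + 1)))) atTop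
        (𝓝 (ENNReal.ofReal (M - b))) := by
      refine ENNReal.tendsto_ofReal ?_
      have h := (tendsto_one_div_add_atTop_nhds_zero_nat (𝕜 := ℝ)).comp hφ.tendsto_atTop
      simpa using (h.const_sub b).const_sub M
    -- Since `f` may be unbounded below, weak convergence gives only this inequality, in the
    -- direction needed.
    calc ∫⁻ x, ENNReal.ofReal (M - f x) ∂(ν : Measure (MarkovShift A))
        ≤ atTop.liminf fun k => ∫⁻ x, ENNReal.ofReal (M - f x) ∂(μ (φ k)) :=
          lintegral_le_liminf_lintegral_of_forall_isOpen_measure_le_liminf_measure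
            (continuous_const.sub hvar.continuous) (fun x => sub_nonneg.2 (hM x))
            fun G hG => ProbabilityMeasure.le_liminf_measure_open_of_tendsto hν hG
      _ ≤ atTop.liminf fun k : ℕ => ENNReal.ofReal (M - (b - 1 / ((φ k : ℝ) + 1))) :=
          liminf_le_liminf (.of_forall fun k => hμ (φ k))
      _ = ENNReal.ofReal (M - b) := hlim.liminf_eq

/-- An upper bound of `f` bounds the value above; the periodic orbit of a loop through the symbol
`0` bounds it below. -/
theorem exists_maxErgodicValue_eq_coe (hA : IrreducibleTransition A) (hvar : BoundedVariation f)
    (hcoer : Coercive f) : ∃ b : ℝ, maxErgodicValue (shift (A := A)) f = b := by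
  have hm : Measurable f := hvar.continuous.measurable
  obtain ⟨M, hM⟩ := hcoer.exists_le hvar
  have htop : maxErgodicValue (shift (A := A)) f ≤ M := iSup₂_le fun μ hμ => by
    have := hμ.1
    exact extIntegral_le hm hM
  obtain ⟨n, hn, c, hc0, hcn, hc⟩ :=
    (irreducibleTransition_iff_transGen.1 hA 0 0).exists_path
  have hw : ∀ k, A (c (k % n)) (c ((k + 1) % n)) = 1 := by
    intro k
    have hlt := Nat.mod_lt k hn
    have h := hc _ hlt
    rcases Nat.lt_or_ge (k % n + 1) n with h1 | h1
    · have : (k + 1) % n = k % n + 1 := by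
        rw [← Nat.mod_add_mod, Nat.mod_eq_of_lt h1]
      rwa [this]
    · have h2 : k % n + 1 = n := by omega
      have : (k + 1) % n = 0 := by
        rw [← Nat.mod_add_mod, h2, Nat.mod_self]
      rw [this, hc0, ← hcn]
      rwa [h2] at h
  have hz : shift^[n] (⟨fun k => c (k % n), hw⟩ : MarkovShift A) = ⟨fun k => c (k % n), hw⟩ := by
    ext i
    rw [iterate_shift_apply]
    simp
  have hbot := birkhoffSum_le_of_isPeriodicPt measurable_shift hm hn hz
  refine ⟨(maxErgodicValue (shift (A := A)) f).toReal, (EReal.coe_toReal ?_ ?_).symm⟩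
  · exact (htop.trans_lt (EReal.coe_lt_top M)).ne
  · exact ((EReal.bot_lt_coe _).trans_le hbot).ne'

/-- Every maximizing measure is carried by the sequences with symbols in a fixed finite set. -/
theorem exists_finite_ae_mem_subshift (hA : IrreducibleTransition A) (hvar : BoundedVariation f)
    (hcoer : Coercive f) :
    ∃ F : Finset ℕ, ∀ ν : Measure (MarkovShift A), IsMaximizing shift f ν →
      ∀ᵐ x ∂ν, x ∈ subshift A F := by
  have hm : Measurable f := hvar.continuous.measurable
  obtain ⟨M, hM⟩ := hcoer.exists_le hvar
  obtain ⟨b, hb⟩ := exists_maxErgodicValue_eq_coe hA hvar hcoer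
  obtain ⟨C, hC0, hC⟩ := exists_birkhoffSum_le hA hvar hcoer (b := b) fun p x hp hx => by
    have h := birkhoffSum_le_of_isPeriodicPt measurable_shift hm hp hx
    rw [hb, EReal.coe_le_coe_iff, div_le_iff₀ (by exact_mod_cast hp)] at h
    linarith
  obtain ⟨v, hvm, hv, hfv⟩ := exists_subaction hm hC
  -- Equality in the sub-action inequality and `0 ≤ v ≤ C` force `f - b ≥ -C`.
  refine ⟨(hcoer.finite_symbols (b - C)).toFinset, fun ν hν => ?_⟩
  obtain ⟨⟨_, hinv⟩, hmax⟩ := hν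
  obtain ⟨hint, -⟩ := (coe_le_extIntegral_iff hm hM).1 (hb.symm.trans hmax.symm).le
  have hval : ∫ x, f x ∂ν = b := by
    rw [extIntegral_eq_integral hint, hb] at hmax
    exact EReal.coe_injective hmax
  have hvint : Integrable v ν := Integrable.of_bound hvm.aestronglyMeasurable C
    (.of_forall fun x => by
      rw [Real.norm_eq_abs, abs_of_nonneg (hv x).1]
      exact (hv x).2)
  have hae := ae_eq_of_le_coboundary hinv hint hval hvint hfv
  have hall : ∀ᵐ x ∂ν, ∀ i, f (shift^[i] x) - b = v (shift^[i] x) - v (shift (shift^[i] x)) :=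
    ae_all_iff.2 fun i => (hinv.iterate i).quasiMeasurePreserving.ae hae
  filter_upwards [hall] with x hx i
  rw [Set.Finite.coe_toFinset]
  refine ⟨shift^[i] x, by simp [iterate_shift_apply], ?_⟩
  have h1 := (hv (shift^[i] x)).1
  have h2 := (hv (shift (shift^[i] x))).2
  linarith [hx i]

/-! ### Transfer of invariant measures between shift and subshift -/

theorem measurable_subshiftMap (S : Set ℕ) : Measurable (subshiftMap A S) :=
  (measurable_shift.comp measurable_subtype_coe).subtype_mk

theorem maxErgodicValue_subshiftMap_le (hm : Measurable f) (S : Set ℕ) :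
    maxErgodicValue (subshiftMap A S) (fun x => f x.1) ≤ maxErgodicValue shift f := by
  refine iSup₂_le fun μ hμ => ?_
  have := hμ.1
  have hmap : μ.map Subtype.val ∈ invariantProb (shift (A := A)) := by
    refine ⟨Measure.isProbabilityMeasure_map measurable_subtype_coe.aemeasurable,
      measurable_shift, ?_⟩
    conv_rhs => rw [← hμ.2.map_eq]
    rw [Measure.map_map measurable_shift measurable_subtype_coe,
      Measure.map_map measurable_subtype_coe (measurable_subshiftMap S)]
    rfl
  refine le_iSup₂_of_le _ hmap ?_
  rw [extIntegral_map measurable_subtype_coe hm]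
  rfl

theorem extIntegral_le_maxErgodicValue_subshiftMap (hm : Measurable f) {S : Set ℕ}
    {ν : Measure (MarkovShift A)} (hν : ν ∈ invariantProb shift)
    (hS : ∀ᵐ x ∂ν, x ∈ subshift A S) :
    extIntegral f ν ≤ maxErgodicValue (subshiftMap A S) (fun x => f x.1) := by
  have := hν.1
  have hemb : MeasurableEmbedding (Subtype.val : subshift A S → MarkovShift A) :=
    .subtype_coe (isClosed_subshift S).measurableSet
  set μ := ν.comap (Subtype.val : subshift A S → MarkovShift A) with hμ
  have hmap : μ.map Subtype.val = ν := by
    rw [hμ, hemb.map_comap, Subtype.range_coe, Measure.restrict_eq_self_of_ae_mem hS]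
  have hinv : μ ∈ invariantProb (subshiftMap A S) := by
    refine ⟨⟨?_⟩, measurable_subshiftMap S, ?_⟩
    · rw [← Set.preimage_univ (f := (Subtype.val : subshift A S → MarkovShift A)),
        ← hemb.map_apply, hmap, measure_univ]
    -- Pushing forward along a measurable embedding is injective, so invariance can be checked after
    -- inclusion into the full shift.
    · have h : (μ.map (subshiftMap A S)).map Subtype.val = μ.map Subtype.val := by
        rw [Measure.map_map measurable_subtype_coe (measurable_subshiftMap S)]
        conv_rhs => rw [hmap, ← hν.2.map_eq, ← hmap]
        rw [Measure.map_map measurable_shift measurable_subtype_coe]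
        rfl
      rw [← hemb.comap_map (μ.map (subshiftMap A S)), h, hemb.comap_map]
  refine le_iSup₂_of_le μ hinv ?_
  conv_lhs => rw [← hmap]
  rw [extIntegral_map measurable_subtype_coe hm]
  rfl

end MarkovShift

theorem theorem1 (A : Matrix ℕ ℕ (Fin 2)) (hA : IrreducibleTransition A)
    (f : MarkovShift A → ℝ) (hvar : MarkovShift.BoundedVariation f)
    (hcoer : MarkovShift.Coercive f) :
    (∃ b : ℝ, maxErgodicValue (MarkovShift.shift (A := A)) f = (b : EReal)) ∧
    ∃ 𝒜 : Finset ℕ,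
      IrreducibleTransition (A.submatrix ((↑) : 𝒜 → ℕ) ((↑) : 𝒜 → ℕ)) ∧
      IsCompact (MarkovShift.subshift A (𝒜 : Set ℕ)) ∧
      maxErgodicValue (MarkovShift.shift (A := A)) f =
        maxErgodicValue (MarkovShift.subshiftMap A (𝒜 : Set ℕ)) (fun x => f x.1) ∧
      (∃ ν : Measure (MarkovShift A), IsMaximizing MarkovShift.shift f ν ∧
        ν.support ⊆ MarkovShift.subshift A (𝒜 : Set ℕ)) ∧
      ∀ ν : Measure (MarkovShift A), IsMaximizing MarkovShift.shift f ν →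
        ν.support ⊆ MarkovShift.subshift A (𝒜 : Set ℕ) := by
  have hm : Measurable f := hvar.continuous.measurable
  obtain ⟨b, hb⟩ := MarkovShift.exists_maxErgodicValue_eq_coe hA hvar hcoer
  obtain ⟨F, hF⟩ := MarkovShift.exists_finite_ae_mem_subshift hA hvar hcoer
  obtain ⟨S, hFS, hS⟩ := hA.exists_finset F
  have hae : ∀ ν : Measure (MarkovShift A), IsMaximizing MarkovShift.shift f ν →
      ∀ᵐ x ∂ν, x ∈ MarkovShift.subshift A (S : Set ℕ) := fun ν hν => by
    filter_upwards [hF ν hν] with x hx i using hFS (hx i)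
  have hsupp : ∀ ν : Measure (MarkovShift A), IsMaximizing MarkovShift.shift f ν →
      ν.support ⊆ MarkovShift.subshift A (S : Set ℕ) := fun ν hν =>
    Measure.support_subset_of_isClosed (MarkovShift.isClosed_subshift _) (hae ν hν)
  obtain ⟨ν, hν⟩ := MarkovShift.exists_isMaximizing hvar hcoer hb
  refine ⟨⟨b, hb⟩, S, hS, MarkovShift.isCompact_setOf_forall_mem (fun _ => S)
    fun _ => S.finite_toSet, le_antisymm ?_ (MarkovShift.maxErgodicValue_subshiftMap_le hm _),
    ⟨ν, hν, hsupp ν hν⟩, hsupp⟩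
  rw [← hν.2]
  exact MarkovShift.extIntegral_le_maxErgodicValue_subshiftMap hm hν.1 (hae ν hν)
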